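/- Consider a normal-form game with a finite set $N$ of players, action sets $A_i$, action profiles $A=\prod_{i\in N}A_i$ and utilities $u_i:A\to\mathbb{R}$. Call the game \emph{strictly socially concave} if each $A_i$ is a nonempty compact convex subset of a finite-dimensional real normed space (e.g. of $\mathbb{R}^d$), the utilitarian welfare $\sum_i u_i(a)$ is strictly concave in $a\in A$, and, for every player $i$, the payoff $u_i(a_i,a_{-i})$ is continuous in $a\in A$ and, for each fixed $a_i$, convex in $a_{-i}$. A \emph{coarse correlated equilibrium} (CCE) is a Borel probability measure $\mu$ on $A$ such that $\int u_i(a)\,d\mu(a)\ge\int u_i(a_i',a_{-i})\,d\mu(a)$ for every player $i$ and every $a_i'\in A_i$. (1) Every strictly socially concave game has a unique CCE; it is the point mass $\delta_{a^*}$ at a pure Nash equilibrium $a^*$. (2) In particular, let each $A_i\subset\mathbb{R}$ be a nonempty compact interval and each cost function $c_i$ strictly convex and continuous on $A_i$. For $\alpha\in\mathbb{R}$ and $\beta\ge 0$, the linear Cournot oligopoly $u_i(a)=a_i\bigl(\alpha-\beta\sum_j a_j\bigr)-c_i(a_i)$ is strictly socially concave and has a unique CCE. (3) Let $A_i$ and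 $c_i$ be as in (2), and suppose moreover that $A_i\subset[0,\infty)$ and that $\sum_j a_j>0$ for every $a\in A$ (for instance, because $A_i\subset(0,\infty)$ for all $i$ and $N\neq\emptyset$). For valuations $v_i>0$, the Tullock contest $u_i(a)=v_i\,\dfrac{a_i}{\sum_j a_j}-c_i(a_i)$ has a unique CCE; if all $v_i$ are equal, this contest is strictly socially concave. -/

import Mathlib

open MeasureTheory

/-- A normal-form game with set of players `ι`, in which player `i` chooses an action from a set
`A i` contained in an ambient space `E i`.  The utility functions are only ever evaluated at
profiles of available actions; their values elsewhere are irrelevant. -/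
structure Game (ι : Type*) (E : ι → Type*) where
  /-- the action set of each player -/
  A : ∀ i, Set (E i)
  /-- the utility of each player, as a function of the whole action profile -/
  u : ι → (∀ i, E i) → ℝ

namespace Game

/-- The set of action profiles, i.e. the product of the action sets. -/
def profiles {ι : Type*} {E : ι → Type*} (G : Game ι E) : Set (∀ i, E i) :=
  Set.univ.pi G.A

/-- A pure Nash equilibrium: no player gains by a unilateral deviation. -/
def IsPureNash {ι : Type*} [DecidableEq ι] {E : ι → Type*} (G : Game ι E) (a : ∀ i, E i) : Prop :=
  a ∈ G.profiles ∧ ∀ i, ∀ x ∈ G.A i, G.u i (Function.update a i x) ≤ G.u i a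

/-- The distributions over action profiles: probability measures on the ambient space that are
concentrated on the set of action profiles. -/
def distributions {ι : Type*} {E : ι → Type*} [∀ i, MeasurableSpace (E i)] (G : Game ι E) :
    Set (Measure (∀ i, E i)) :=
  {μ | IsProbabilityMeasure μ ∧ ∀ᵐ a ∂μ, a ∈ G.profiles}

/-- The set of coarse correlated equilibria: distributions `μ` over action profiles such that no
player `i` gains in expectation by committing to a fixed action `x` while the others keep playing
according to `μ`.  (For utilities that are bounded and measurable on the action profiles, in
particular for continuous utilities on compact action sets, both integrands are integrable.) -/
def CCE {ι : Type*} [DecidableEq ι] {E : ι → Type*} [∀ i, MeasurableSpace (E i)] (G : Game ι E) :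
    Set (Measure (∀ i, E i)) :=
  {μ | μ ∈ G.distributions ∧
    ∀ i, ∀ x ∈ G.A i, ∫ a, G.u i (Function.update a i x) ∂μ ≤ ∫ a, G.u i a ∂μ}

/-- Strictly socially concave games. -/
structure IsStrictlySociallyConcave {ι : Type*} [Fintype ι] {E : ι → Type*}
    [∀ i, NormedAddCommGroup (E i)] [∀ i, NormedSpace ℝ (E i)] (G : Game ι E) : Prop where
  nonempty : ∀ i, (G.A i).Nonempty
  isCompact : ∀ i, IsCompact (G.A i)
  convex : ∀ i, Convex ℝ (G.A i)
  /-- the utilitarian welfare is strictly concave in the whole profile -/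
  welfare : StrictConcaveOn ℝ G.profiles (fun a => ∑ i, G.u i a)
  /-- the payoff of `i` is jointly continuous in the profile -/
  continuousOn : ∀ i, ContinuousOn (G.u i) G.profiles
  /-- for each fixed own action `x`, the payoff of `i` is convex in the actions of the others -/
  convexOn : ∀ i, ∀ x ∈ G.A i, ConvexOn ℝ {a | a ∈ G.profiles ∧ a i = x} (G.u i)

/-- The linear Cournot oligopoly with inverse demand `α - β ∑ j, a j` and production costs `c i`. -/
def cournot {ι : Type*} [Fintype ι] (A : ι → Set ℝ) (α β : ℝ) (c : ι → ℝ → ℝ) :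
    Game ι (fun _ => ℝ) where
  A := A
  u := fun i a => a i * (α - β * ∑ j, a j) - c i (a i)

/-- The Tullock contest with valuations `v i` of the prize and effort costs `c i`. -/
noncomputable def tullock {ι : Type*} [Fintype ι] (A : ι → Set ℝ) (v : ι → ℝ) (c : ι → ℝ → ℝ) :
    Game ι (fun _ => ℝ) where
  A := A
  u := fun i a => v i * (a i / ∑ j, a j) - c i (a i)

end Game

open Function Set

/-! Let `m` be the barycenter of a CCE `μ`. Jensen, applied to the payoff of `i` with own action
frozen at `m i`, followed by the CCE inequality for the deviation `m i`, gives `G.u i m ≤ ∫ a, G.u i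
a ∂μ`. Summed over `i`, this contradicts strict Jensen for welfare unless `μ` is the point mass at
`m` (`exists_eq_dirac`). Point masses in `CCE` are the pure Nash equilibria, so it remains to show
that exactly one exists. Existence is Sion's theorem for the Nikaido-Isoda function, convex in the
first profile and concave in the second; uniqueness follows by mixing two equilibria. -/

theorem Function.update_smul_add_smul {ι : Type*} [DecidableEq ι] {E : ι → Type*}
    [∀ i, AddCommGroup (E i)] [∀ i, Module ℝ (E i)] (p q : ℝ) (a b : ∀ i, E i) (i : ι)
    (x y : E i) :
    update (p • a + q • b) i (p • x + q • y) = p • update a i x + q • update b i y := by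
  ext j
  rcases eq_or_ne j i with rfl | h <;> simp [*]

/-- A separable sum of strictly convex functions is strictly convex on the product. -/
theorem StrictConvexOn.sum_pi {ι : Type*} [Fintype ι] {E : ι → Type*}
    [∀ i, AddCommGroup (E i)] [∀ i, Module ℝ (E i)] {A : ∀ i, Set (E i)} {c : ∀ i, E i → ℝ}
    (hc : ∀ i, StrictConvexOn ℝ (A i) (c i)) :
    StrictConvexOn ℝ (univ.pi A) (fun a => ∑ i, c i (a i)) := by
  refine ⟨convex_pi fun i _ => (hc i).1, fun a ha b hb hab p q hp hq hpq => ?_⟩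
  obtain ⟨j, hj⟩ := Function.ne_iff.1 hab
  simp only [smul_eq_mul, Finset.mul_sum, ← Finset.sum_add_distrib]
  refine Finset.sum_lt_sum (fun i _ => ?_) ⟨j, Finset.mem_univ j, ?_⟩
  · exact (hc i).convexOn.2 (ha i trivial) (hb i trivial) hp.le hq.le hpq
  · exact (hc j).2 (ha j trivial) (hb j trivial) hj hp hq hpq

namespace Game

/-! ### Convexity structure and existence of a pure equilibrium -/

section General

variable {ι : Type*} {E : ι → Type*}

theorem update_mem_profiles [DecidableEq ι] {G : Game ι E} {a : ∀ i, E i} (ha : a ∈ G.profiles)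
    {i : ι} {x : E i} (hx : x ∈ G.A i) : update a i x ∈ G.profiles := by
  intro j _
  rcases eq_or_ne j i with rfl | h
  · simpa using hx
  · simpa [h] using ha j trivial

variable [Fintype ι] [∀ i, NormedAddCommGroup (E i)] [∀ i, NormedSpace ℝ (E i)] {G : Game ι E}

namespace IsStrictlySociallyConcave

theorem convex_profiles (h : G.IsStrictlySociallyConcave) : Convex ℝ G.profiles :=
  h.welfare.1

theorem isCompact_profiles (h : G.IsStrictlySociallyConcave) : IsCompact G.profiles :=
  isCompact_univ_pi h.isCompact

theorem nonempty_profiles (h : G.IsStrictlySociallyConcave) : G.profiles.Nonempty :=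
  univ_pi_nonempty_iff.2 h.nonempty

variable [DecidableEq ι]

theorem continuousOn_update (h : G.IsStrictlySociallyConcave) (i : ι) {x : E i} (hx : x ∈ G.A i) :
    ContinuousOn (fun a => G.u i (update a i x)) G.profiles :=
  (h.continuousOn i).comp (by fun_prop) fun _ ha => update_mem_profiles ha hx

theorem continuousOn_own (h : G.IsStrictlySociallyConcave) (i : ι) {a : ∀ i, E i}
    (ha : a ∈ G.profiles) : ContinuousOn (fun b => G.u i (update a i (b i))) G.profiles :=
  (h.continuousOn i).comp (s := G.profiles)
    (f := fun b : ∀ i, E i => update a i (b i))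
    (continuous_const.update i (continuous_apply i)).continuousOn
    fun _ hb => update_mem_profiles ha (hb i trivial)

/-- After a deviation of player `i` to `x`, the payoff of `i` is convex in the profile. -/
theorem convexOn_update (h : G.IsStrictlySociallyConcave) (i : ι) {x : E i} (hx : x ∈ G.A i) :
    ConvexOn ℝ G.profiles (fun a => G.u i (update a i x)) := by
  refine ⟨h.convex_profiles, fun a ha b hb p q hp hq hpq => ?_⟩
  have := (h.convexOn i x hx).2 (x := update a i x) ⟨update_mem_profiles ha hx, by simp⟩
    (y := update b i x) ⟨update_mem_profiles hb hx, by simp⟩ hp hq hpq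
  rwa [← update_smul_add_smul, ← add_smul, hpq, one_smul] at this

/-- The payoff of each player is concave in the player's own action. -/
theorem concaveOn_own (h : G.IsStrictlySociallyConcave) (i : ι) {a : ∀ i, E i}
    (ha : a ∈ G.profiles) : ConcaveOn ℝ G.profiles (fun b => G.u i (update a i (b i))) := by
  refine ⟨h.convex_profiles, fun b hb b' hb' p q hp hq hpq => ?_⟩
  have hbm := update_mem_profiles ha (hb i trivial)
  have hbm' := update_mem_profiles ha (hb' i trivial)
  have hupd : update a i ((p • b + q • b') i)
      = p • update a i (b i) + q • update a i (b' i) := by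
    rw [← update_smul_add_smul, ← add_smul, hpq, one_smul]
    simp
  have hW := h.welfare.concaveOn.2 hbm hbm' hp hq hpq
  -- Own payoff is concave welfare minus the others' payoffs, and these are convex here because only
  -- `i` moves.
  have hO : ∑ j ∈ Finset.univ.erase i, G.u j (p • update a i (b i) + q • update a i (b' i))
      ≤ ∑ j ∈ Finset.univ.erase i,
        (p * G.u j (update a i (b i)) + q * G.u j (update a i (b' i))) := by
    refine Finset.sum_le_sum fun j hj => ?_
    have hji : j ≠ i := (Finset.mem_erase.1 hj).1
    exact (h.convexOn j (a j) (ha j trivial)).2 ⟨hbm, by simp [hji]⟩ ⟨hbm', by simp [hji]⟩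
      hp hq hpq
  simp only [← Finset.add_sum_erase Finset.univ _ (Finset.mem_univ i), smul_eq_mul, mul_add] at hW
  rw [Finset.sum_add_distrib, ← Finset.mul_sum, ← Finset.mul_sum] at hO
  simp only [hupd, smul_eq_mul]
  linarith

/-- Existence of a pure Nash equilibrium, by the minimax theorem for the Nikaido-Isoda function. -/
theorem exists_isPureNash (h : G.IsStrictlySociallyConcave) : ∃ a, G.IsPureNash a := by
  have hconv := h.convex_profiles
  obtain ⟨a, ha, b, hb, hab⟩ := Sion.exists_isSaddlePointOn (X := G.profiles) (Y := G.profiles)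
    (f := fun a b => ∑ i, G.u i (update a i (b i)) - ∑ i, G.u i a)
    h.nonempty_profiles hconv h.isCompact_profiles
    (fun b hb => ContinuousOn.lowerSemicontinuousOn <|
      (continuousOn_finsetSum _ fun i _ => h.continuousOn_update i (hb i trivial)).sub
        (continuousOn_finsetSum _ fun i _ => h.continuousOn i))
    (fun b hb => ConvexOn.quasiconvexOn <| by
      refine ConvexOn.sub ?_ h.welfare.concaveOn
      refine ⟨hconv, fun x hx y hy p q hp hq hpq => ?_⟩
      simp only [smul_eq_mul, Finset.mul_sum, ← Finset.sum_add_distrib]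
      exact Finset.sum_le_sum fun i _ =>
        (h.convexOn_update i (hb i trivial)).2 hx hy hp hq hpq)
    hconv h.nonempty_profiles h.isCompact_profiles
    (fun a ha => ContinuousOn.upperSemicontinuousOn <|
      (continuousOn_finsetSum _ fun i _ => h.continuousOn_own i ha).sub continuousOn_const)
    (fun a ha => ConcaveOn.quasiconcaveOn <| by
      refine ConcaveOn.sub ?_ (convexOn_const _ hconv)
      refine ⟨hconv, fun x hx y hy p q hp hq hpq => ?_⟩
      simp only [smul_eq_mul, Finset.mul_sum, ← Finset.sum_add_distrib]
      exact Finset.sum_le_sum fun i _ => (h.concaveOn_own i ha).2 hx hy hp hq hpq)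
  refine ⟨a, ha, fun i x hx => ?_⟩
  -- The function vanishes on the diagonal, so comparison with `(b, b)` bounds every deviation gain
  -- from `a` by 0; in a unilateral deviation only the term of `i` survives.
  have key := hab b hb (update a i x) (update_mem_profiles ha hx)
  simp only [update_eq_self, sub_self] at key
  rw [← Finset.sum_sub_distrib, Finset.sum_eq_single i (fun j _ hj => by simp [hj])
    (by simp)] at key
  simpa using key

/-! ### Collapse of coarse correlated equilibria to point masses -/

variable [∀ i, FiniteDimensional ℝ (E i)] [∀ i, MeasurableSpace (E i)] [∀ i, BorelSpace (E i)]

omit [DecidableEq ι] in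
theorem integrable_of_continuousOn (h : G.IsStrictlySociallyConcave) {F : Type*}
    [NormedAddCommGroup F] [SecondCountableTopology F]
    {μ : Measure (∀ i, E i)} (hμ : μ ∈ G.distributions) {f : (∀ i, E i) → F}
    (hf : ContinuousOn f G.profiles) : Integrable f μ := by
  have := hμ.1
  have : ∀ i, SecondCountableTopology (E i) := fun i =>
    have := FiniteDimensional.proper_real (E i)
    inferInstance
  borelize F
  have hint := hf.integrableOn_compact (μ := μ) h.isCompact_profiles
  rwa [IntegrableOn, Measure.restrict_eq_self_of_ae_mem hμ.2] at hint

/-- A coarse correlated equilibrium is concentrated at its barycenter. -/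
theorem exists_eq_dirac (h : G.IsStrictlySociallyConcave) {μ : Measure (∀ i, E i)}
    (hμ : μ ∈ G.CCE) : ∃ a ∈ G.profiles, μ = Measure.dirac a := by
  have hd := hμ.1
  have := hd.1
  have : ∀ i, SecondCountableTopology (E i) := fun i =>
    have := FiniteDimensional.proper_real (E i)
    inferInstance
  have hclosed := h.isCompact_profiles.isClosed
  have hid : Integrable (fun a : ∀ i, E i => a) μ :=
    h.integrable_of_continuousOn hd continuousOn_id
  have hmem : (∫ a, a ∂μ) ∈ G.profiles := h.convex_profiles.integral_mem hclosed hd.2 hid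
  have hu (i : ι) : Integrable (G.u i) μ := h.integrable_of_continuousOn hd (h.continuousOn i)
  set m := ∫ a, a ∂μ with hm
  refine ⟨m, hmem, ?_⟩
  have hle (i : ι) : G.u i m ≤ ∫ a, G.u i a ∂μ := by
    have hJ := (h.convexOn_update i (hmem i trivial)).map_integral_le
      (h.continuousOn_update i (hmem i trivial)) hclosed hd.2 hid
      (h.integrable_of_continuousOn hd (h.continuousOn_update i (hmem i trivial)))
    rw [← hm, update_eq_self] at hJ
    exact hJ.trans (hμ.2 i _ (hmem i trivial))
  have hcont : ContinuousOn (fun a => ∑ i, G.u i a) G.profiles :=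
    continuousOn_finsetSum _ fun i _ => h.continuousOn i
  rcases h.welfare.ae_eq_const_or_lt_map_average hcont hclosed hd.2 hid
    (h.integrable_of_continuousOn hd hcont) with heq | hlt
  · rw [average_eq_integral, ← hm] at heq
    calc μ = μ.map (fun a => a) := Measure.map_id'.symm
      _ = μ.map (fun _ => m) := Measure.map_congr heq
      _ = Measure.dirac m := by simp [Measure.map_const]
  · rw [average_eq_integral, average_eq_integral, ← hm,
      integral_finsetSum _ fun i _ => hu i] at hlt
    exact absurd (Finset.sum_le_sum fun i _ => hle i) hlt.not_ge

theorem dirac_mem_CCE_iff (a : ∀ i, E i) :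
    Measure.dirac a ∈ G.CCE ↔ G.IsPureNash a := by
  have : ∀ i, SecondCountableTopology (E i) := fun i =>
    have := FiniteDimensional.proper_real (E i)
    inferInstance
  simp [CCE, distributions, IsPureNash, integral_dirac, ae_dirac_eq, Measure.dirac.isProbabilityMeasure]

/-- The CCE conditions are linear in the measure, so the even mixture of two equilibria is a CCE;
being a point mass, it has both atoms at the same profile. -/
theorem isPureNash_unique (h : G.IsStrictlySociallyConcave) {a b : ∀ i, E i}
    (ha : G.IsPureNash a) (hb : G.IsPureNash b) : a = b := by
  have : ∀ i, SecondCountableTopology (E i) := fun i =>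
    have := FiniteDimensional.proper_real (E i)
    inferInstance
  let r : ENNReal := 2⁻¹
  have hmix : r • Measure.dirac a + r • Measure.dirac b ∈ G.CCE := by
    refine ⟨⟨⟨by simp [r, ENNReal.inv_two_add_inv_two]⟩, ?_⟩, fun i x hx => ?_⟩
    · rw [ae_add_measure_iff]
      exact ⟨Measure.ae_smul_measure (by simpa using ha.1) _,
        Measure.ae_smul_measure (by simpa using hb.1) _⟩
    · have hint (f : (∀ i, E i) → ℝ) :
          ∫ y, f y ∂(r • Measure.dirac a + r • Measure.dirac b)
            = r.toReal * f a + r.toReal * f b := by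
        rw [integral_add_measure ((integrable_dirac (by simp)).smul_measure (by simp [r]))
          ((integrable_dirac (by simp)).smul_measure (by simp [r]))]
        simp
      rw [hint, hint]
      gcongr
      · exact ha.2 i x hx
      · exact hb.2 i x hx
  obtain ⟨m, -, hm⟩ := h.exists_eq_dirac hmix
  have hr : r ≠ 0 := by simp [r]
  have hmem (c : ∀ i, E i) (hc : c = a ∨ c = b) : c = m := by
    by_contra hcm
    have h0 : Measure.dirac m {c} = 0 := by simp [Ne.symm hcm]
    rw [← hm] at h0
    rcases hc with rfl | rfl <;> simp [hr] at h0
  rw [hmem a (.inl rfl), ← hmem b (.inr rfl)]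

/-- The unique coarse correlated equilibrium is the point mass at a pure Nash equilibrium. -/
theorem exists_isPureNash_and_CCE_eq (h : G.IsStrictlySociallyConcave) :
    ∃ a, G.IsPureNash a ∧ G.CCE = {Measure.dirac a} := by
  obtain ⟨a, ha⟩ := h.exists_isPureNash
  refine ⟨a, ha, Set.eq_singleton_iff_unique_mem.2 ⟨(dirac_mem_CCE_iff a).2 ha, fun μ hμ => ?_⟩⟩
  obtain ⟨b, -, rfl⟩ := h.exists_eq_dirac hμ
  rw [h.isPureNash_unique ha ((dirac_mem_CCE_iff b).1 hμ)]

theorem existsUnique_CCE (h : G.IsStrictlySociallyConcave) : ∃! μ, μ ∈ G.CCE := by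
  obtain ⟨a, -, ha⟩ := h.exists_isPureNash_and_CCE_eq
  simp [ha]

end IsStrictlySociallyConcave

end General

/-! ### Cournot oligopolies and Tullock contests -/

section Examples

variable {ι : Type*} [Fintype ι] {A : ι → Set ℝ} {c : ι → ℝ → ℝ}

theorem isStrictlySociallyConcave_cournot {α β : ℝ} (hβ : 0 ≤ β)
    (hA : ∀ i, (A i).Nonempty ∧ IsCompact (A i) ∧ Convex ℝ (A i))
    (hc : ∀ i, StrictConvexOn ℝ (A i) (c i) ∧ ContinuousOn (c i) (A i)) :
    (cournot A α β c).IsStrictlySociallyConcave where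
  nonempty i := (hA i).1
  isCompact i := (hA i).2.1
  convex i := (hA i).2.2
  welfare := by
    have hR : ConcaveOn ℝ (univ.pi A) (fun a => (∑ j, a j) * (α - β * ∑ j, a j)) := by
      refine ⟨convex_pi fun i _ => (hA i).2.2, fun a _ b _ p q hp hq hpq => ?_⟩
      obtain rfl : q = 1 - p := by linarith
      simp only [Pi.add_apply, Pi.smul_apply, smul_eq_mul, Finset.sum_add_distrib,
        ← Finset.mul_sum]
      -- This is exactly the concavity gap of `S * (α - β * S)`, with `S` the total output.
      have := mul_nonneg hβ (mul_nonneg (mul_nonneg hp hq) (sq_nonneg (∑ j, a j - ∑ j, b j)))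
      linarith
    have := hR.sub_strictConvexOn (StrictConvexOn.sum_pi fun i => (hc i).1)
    refine this.congr fun a _ => ?_
    simp [cournot, Finset.sum_mul]
  continuousOn i := by
    refine ContinuousOn.sub (by fun_prop) ((hc i).2.comp (by fun_prop) fun a ha => ha i trivial)
  convexOn i x _ := by
    refine ⟨(convex_pi fun i _ => (hA i).2.2).inter (convex_hyperplane
      (LinearMap.proj (R := ℝ) (φ := fun _ : ι => ℝ) i).isLinear x),
      fun a ha b hb p q _ _ hpq => ?_⟩
    obtain rfl : q = 1 - p := by linarith
    have hx : p * x + (1 - p) * x = x := by ring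
    simp only [cournot, Pi.add_apply, Pi.smul_apply, smul_eq_mul, Finset.sum_add_distrib,
      ← Finset.mul_sum, ha.2, hb.2, hx]
    linarith

/-- With equal valuations the shares sum to a constant prize, leaving only the costs in the welfare.
For fixed own effort `x ≥ 0`, convexity comes from that of the reciprocal of total effort. -/
theorem isStrictlySociallyConcave_tullock {v : ι → ℝ} (hv : ∀ i, 0 < v i)
    (hA : ∀ i, (A i).Nonempty ∧ IsCompact (A i) ∧ Convex ℝ (A i) ∧ A i ⊆ Ici 0)
    (hpos : ∀ a ∈ univ.pi A, 0 < ∑ j, a j)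
    (hc : ∀ i, StrictConvexOn ℝ (A i) (c i) ∧ ContinuousOn (c i) (A i))
    (heq : ∀ i j, v i = v j) : (tullock A v c).IsStrictlySociallyConcave where
  nonempty i := (hA i).1
  isCompact i := (hA i).2.1
  convex i := (hA i).2.2.1
  welfare := by
    obtain ⟨w, hw⟩ : ∃ w, ∀ i, v i = w := by
      rcases isEmpty_or_nonempty ι with hι | ⟨⟨i⟩⟩
      · exact ⟨0, fun i => hι.elim i⟩
      · exact ⟨v i, fun j => heq j i⟩
    have := (concaveOn_const w (convex_pi (s := univ) fun i _ =>
      (hA i).2.2.1)).sub_strictConvexOn (StrictConvexOn.sum_pi fun i => (hc i).1)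
    refine this.congr fun a ha => ?_
    simp [tullock, hw, ← Finset.mul_sum, ← Finset.sum_div, div_self (hpos a ha).ne']
  continuousOn i := by
    refine ContinuousOn.sub (continuousOn_const.mul (ContinuousOn.div (by fun_prop) (by fun_prop)
      fun a ha => (hpos a ha).ne')) ((hc i).2.comp (by fun_prop) fun a ha => ha i trivial)
  convexOn i x hx := by
    refine ⟨(convex_pi fun i _ => (hA i).2.2.1).inter (convex_hyperplane
      (LinearMap.proj (R := ℝ) (φ := fun _ : ι => ℝ) i).isLinear x),
      fun a ha b hb p q hp hq hpq => ?_⟩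
    have hinv := (convexOn_zpow (𝕜 := ℝ) (-1)).2 (hpos a ha.1) (hpos b hb.1) hp hq hpq
    have hvx : 0 ≤ v i * x := mul_nonneg (hv i).le ((hA i).2.2.2 hx)
    have key := mul_le_mul_of_nonneg_left hinv hvx
    obtain rfl : q = 1 - p := by linarith
    have hx : p * x + (1 - p) * x = x := by ring
    simp only [zpow_neg_one, smul_eq_mul] at key
    simp only [tullock, Pi.add_apply, Pi.smul_apply, smul_eq_mul, Finset.sum_add_distrib,
      ← Finset.mul_sum, ha.2, hb.2, hx, div_eq_mul_inv]
    linarith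

/-- Rescaling the payoff of each player so that all valuations become `1` does not change the
coarse correlated equilibria. -/
theorem CCE_tullock_eq [DecidableEq ι] {v : ι → ℝ} (hv : ∀ i, 0 < v i) :
    (tullock A v c).CCE = (tullock A 1 fun i x => (v i)⁻¹ * c i x).CCE := by
  have hu (i : ι) (a : ι → ℝ) : (tullock A v c).u i a
      = v i * (tullock A 1 fun i x => (v i)⁻¹ * c i x).u i a := by
    have := (hv i).ne'
    simp [tullock, mul_sub, this]
  ext μ
  refine and_congr Iff.rfl (forall_congr' fun i => forall₂_congr fun x _ => ?_)
  simp only [hu, integral_const_mul]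
  exact mul_le_mul_iff_right₀ (hv i)

theorem existsUnique_CCE_tullock [DecidableEq ι] {v : ι → ℝ} (hv : ∀ i, 0 < v i)
    (hA : ∀ i, (A i).Nonempty ∧ IsCompact (A i) ∧ Convex ℝ (A i) ∧ A i ⊆ Ici 0)
    (hpos : ∀ a ∈ univ.pi A, 0 < ∑ j, a j)
    (hc : ∀ i, StrictConvexOn ℝ (A i) (c i) ∧ ContinuousOn (c i) (A i)) :
    ∃! μ, μ ∈ (tullock A v c).CCE := by
  rw [CCE_tullock_eq hv]
  refine (isStrictlySociallyConcave_tullock (fun _ => one_pos) hA hpos (fun i => ⟨?_, ?_⟩)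
    fun _ _ => rfl).existsUnique_CCE
  · refine ⟨(hc i).1.1, fun x hx y hy hxy p q hp hq hpq => ?_⟩
    have := mul_lt_mul_of_pos_left ((hc i).1.2 hx hy hxy hp hq hpq) (inv_pos.2 (hv i))
    simp only [smul_eq_mul] at this ⊢
    linarith
  · exact continuousOn_const.mul (hc i).2

end Examples

end Game

theorem mainTheorem8 {ι : Type*} [Fintype ι] [DecidableEq ι] :
    -- every strictly socially concave game has exactly one CCE, and it is a pure Nash equilibrium
    (∀ (E : ι → Type*) [∀ i, NormedAddCommGroup (E i)] [∀ i, NormedSpace ℝ (E i)]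
        [∀ i, FiniteDimensional ℝ (E i)] [∀ i, MeasurableSpace (E i)] [∀ i, BorelSpace (E i)]
        (G : Game ι E), G.IsStrictlySociallyConcave →
        (∃! μ, μ ∈ G.CCE) ∧ ∃ a, G.IsPureNash a ∧ G.CCE = {Measure.dirac a}) ∧
    -- linear Cournot oligopolies with strictly convex costs
    (∀ (A : ι → Set ℝ) (α β : ℝ) (c : ι → ℝ → ℝ), 0 ≤ β →
        (∀ i, (A i).Nonempty ∧ IsCompact (A i) ∧ Convex ℝ (A i)) →
        (∀ i, StrictConvexOn ℝ (A i) (c i) ∧ ContinuousOn (c i) (A i)) →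
        (Game.cournot A α β c).IsStrictlySociallyConcave ∧
        ∃! μ, μ ∈ (Game.cournot A α β c).CCE) ∧
    -- Tullock contests with strictly convex costs
    (∀ (A : ι → Set ℝ) (v : ι → ℝ) (c : ι → ℝ → ℝ), (∀ i, 0 < v i) →
        (∀ i, (A i).Nonempty ∧ IsCompact (A i) ∧ Convex ℝ (A i) ∧ A i ⊆ Set.Ici 0) →
        (∀ a ∈ Set.univ.pi A, 0 < ∑ j, a j) →
        (∀ i, StrictConvexOn ℝ (A i) (c i) ∧ ContinuousOn (c i) (A i)) →
        ((∀ i j, v i = v j) → (Game.tullock A v c).IsStrictlySociallyConcave) ∧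
        ∃! μ, μ ∈ (Game.tullock A v c).CCE) := by
  refine ⟨fun E _ _ _ _ _ G h => ⟨h.existsUnique_CCE, h.exists_isPureNash_and_CCE_eq⟩,
    fun A α β c hβ hA hc => ?_, fun A v c hv hA hpos hc =>
      ⟨Game.isStrictlySociallyConcave_tullock hv hA hpos hc,
        Game.existsUnique_CCE_tullock hv hA hpos hc⟩⟩
  have h := Game.isStrictlySociallyConcave_cournot (α := α) hβ hA hc
  exact ⟨h, h.existsUnique_CCE⟩
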